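/- Let $f(z)=\sum_{j=0}^{\infty}a_jz^j$, $a_j\in\mathbb{R}$, be a real entire function all of whose zeros, except possibly a zero at the origin, lie in the open left half plane $\operatorname{Re} z<0$. Suppose that $f$ has the Weierstrass factorization $$f(z)=z^{p}e^{Az^{2}+Bz+C}\prod_{j}\Bigl(1-\frac{z}{z_j}\Bigr)e^{z/z_j},$$ where $p\ge 0$ is an integer, $A$ is real with $A\ge 0$, $B,C\in\mathbb{C}$, $(z_j)$ is a finite (possibly empty) or infinite sequence of nonzero complex numbers, $\sum_j 1/|z_j|<\infty$, and $B+\sum_j 1/z_j$ is real and positive. Then for each $r\in\{0,1,2,3\}$, the function $$f_r(z)=\sum_{j\equiv r\ (\mathrm{mod}\ 4)}a_jz^j$$ is entire and all its zeros lie on the four rays given by $\operatorname{Im} z^4=0$ and $\operatorname{Re} z^4\le 0$. -/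

import Mathlib

open scoped ComplexOrder

/-- For a real coefficient sequence `a`, the function
`w ↦ ∑_{j ≡ r (mod m)} a_j w ^ j`. -/
noncomputable def sectionMod (a : ℕ → ℝ) (m r : ℕ) (w : ℂ) : ℂ :=
  ∑' j : ℕ, if j ≡ r [MOD m] then (a j : ℂ) * w ^ j else 0

/-! The proof approximates by polynomials. Put `β = B + ∑ 1 / z_j > 0`. Because the reciprocals of the
zeros are summable, `f w = e ^ C * w ^ p * g w` with `g w = exp (A w ^ 2 + β w) * ∏ (1 - w / z_j)`,
and since `f` is real its zeros come in conjugate pairs with equal multiplicities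
(`ncard_zeros_eq_ncard_zeros_conj`). So `g` is a pointwise limit of real polynomials with all zeros
in the open left half plane (`exists_hurwitzStable_tendsto`).

For such a polynomial `q`, unless it is constant, `‖q (-w)‖ < ‖q w‖` whenever `0 < re w`. Hence
(Hermite-Biehler) in `q = E (X ^ 2) + X * O (X ^ 2)` both `E` and `O` have only negative zeros; if `q`
is constant, then `O = 0`. Nonzero parts are thus stable again, the argument applies to them too,
and in `q = ∑ s < 4, X ^ s * Q_s (X ^ 4)` each nonzero `Q_s` has only negative zeros
(`HurwitzStable.negRooted_quarterPart`).

To pass to the limit, a quantitative bound takes the place of Hurwitz's theorem: for `u` off the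
closed negative axis, `|Q 0| ^ (K + 1) ≤ ‖Q u‖ * |Q ‖u‖| ^ K` for every `Q` with negative zeros, where
`K` depends on `u` only (`exists_abs_coeff_zero_pow_le`). The constant terms `Q_s 0` are the low
coefficients of the approximating polynomials, which stay away from zero since `β > 0`. Hence the
sections of `g` do not vanish off the four rays, and multiplication by `w ^ p` only permutes the
residues modulo four. -/

/-! ### Stable polynomials and their sections modulo four -/

section Polynomials

open Polynomial

/-- A real polynomial is Hurwitz stable if all its complex zeros lie in the open left half plane.
The zero polynomial is not stable. -/
def HurwitzStable (p : ℝ[X]) : Prop :=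
  ∀ w : ℂ, aeval w p = 0 → w.re < 0

/-- All complex zeros of the polynomial are negative real numbers. The zero polynomial does not
have this property. -/
def NegRooted (p : ℝ[X]) : Prop :=
  ∀ w : ℂ, aeval w p = 0 → w.im = 0 ∧ w.re < 0

theorem NegRooted.hurwitzStable {p : ℝ[X]} (hp : NegRooted p) : HurwitzStable p :=
  fun w hw => (hp w hw).2

theorem HurwitzStable.ne_zero {p : ℝ[X]} (hp : HurwitzStable p) : p ≠ 0 := by
  rintro rfl
  simpa using hp 0 (by simp)

theorem HurwitzStable.mul {p q : ℝ[X]} (hp : HurwitzStable p) (hq : HurwitzStable q) :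
    HurwitzStable (p * q) := by
  intro w hw
  rw [map_mul, mul_eq_zero] at hw
  exact hw.elim (hp w) (hq w)

theorem HurwitzStable.pow {p : ℝ[X]} (hp : HurwitzStable p) (n : ℕ) :
    HurwitzStable (p ^ n) := by
  intro w hw
  rw [map_pow] at hw
  exact hp w (eq_zero_of_pow_eq_zero hw)

/-- Induction over the real irreducible factors of a stable polynomial: these are `X + a` with
`0 < a` and `X ^ 2 + b X + c` with `0 < b`, `0 < c`. -/
theorem HurwitzStable.induction {P : ℝ[X] → Prop} (const : ∀ c : ℝ, c ≠ 0 → P (C c))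
    (linear : ∀ (a : ℝ) (q : ℝ[X]), 0 < a → P q → P ((X + C a) * q))
    (quadratic : ∀ (b c : ℝ) (q : ℝ[X]), 0 < b → 0 < c → P q → P ((X ^ 2 + C b * X + C c) * q))
    {p : ℝ[X]} (hp : HurwitzStable p) : P p := by
  induction hn : p.natDegree using Nat.strong_induction_on generalizing p with
  | _ n ih =>
    have step : ∀ q r : ℝ[X], p = q * r → 0 < q.natDegree → P r := by
      intro q r hqr hq
      have hr : HurwitzStable r := fun w hw => hp w (by rw [hqr, map_mul, hw, mul_zero])
      have hq0 : q ≠ 0 := by rintro rfl; simp at hq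
      refine ih r.natDegree ?_ hr rfl
      rw [← hn, hqr, natDegree_mul hq0 hr.ne_zero]
      omega
    by_cases hn0 : p.natDegree = 0
    · rw [eq_C_of_natDegree_eq_zero hn0]
      refine const _ fun h => hp.ne_zero ?_
      rw [eq_C_of_natDegree_eq_zero hn0, h, C_0]
    · obtain ⟨w, hw⟩ := IsAlgClosed.exists_aeval_eq_zero ℂ p
        (fun h => hn0 (natDegree_eq_zero_iff_degree_le_zero.2 h.le))
      have hre := hp w hw
      by_cases him : w.im = 0
      · have hroot : p.IsRoot w.re := by
          have hw' : w = ((w.re : ℝ) : ℂ) := Complex.ext rfl (by simp [him])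
          rw [hw', Complex.coe_algebraMap.symm, aeval_algebraMap_apply] at hw
          simpa using hw
        obtain ⟨q, hq⟩ := dvd_iff_isRoot.2 hroot
        have e : p = (X + C (-w.re)) * q := by rw [hq, C_neg, sub_eq_add_neg]
        rw [e]
        exact linear _ _ (by linarith) (step _ _ e (by rw [natDegree_X_add_C]; norm_num))
      · obtain ⟨q, hq⟩ := p.quadratic_dvd_of_aeval_eq_zero_im_ne_zero hw him
        have e : p = (X ^ 2 + C (-(2 * w.re)) * X + C (‖w‖ ^ 2)) * q := by
          rw [hq]; simp only [C_neg, sub_eq_add_neg, neg_mul]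
        have hw0 : w ≠ 0 := by rintro rfl; simp at him
        rw [e]
        refine quadratic _ _ _ (by linarith) (by positivity) (step _ _ e ?_)
        have : (X ^ 2 + C (-(2 * w.re)) * X + C (‖w‖ ^ 2) : ℝ[X]).natDegree = 2 := by
          compute_degree!
        omega

/-- A stable polynomial with positive constant term has nonnegative coefficients, and its linear
coefficient is positive unless the polynomial is constant. -/
theorem HurwitzStable.coeff_nonneg {p : ℝ[X]} (hp : HurwitzStable p) (h0 : 0 < p.coeff 0) :
    (∀ k, 0 ≤ p.coeff k) ∧ (p.natDegree ≠ 0 → 0 < p.coeff 1) := by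
  have mul : ∀ q r : ℝ[X], (∀ k, 0 ≤ q.coeff k) → 0 < q.coeff 0 → 0 < q.coeff 1 →
      (0 < r.coeff 0 → (∀ k, 0 ≤ r.coeff k) ∧ (r.natDegree ≠ 0 → 0 < r.coeff 1)) →
      0 < (q * r).coeff 0 →
      (∀ k, 0 ≤ (q * r).coeff k) ∧ ((q * r).natDegree ≠ 0 → 0 < (q * r).coeff 1) := by
    intro q r hq hq0 hq1 hr h
    have hr0 : 0 < r.coeff 0 := by
      rw [mul_coeff_zero] at h
      exact pos_of_mul_pos_right h hq0.le
    obtain ⟨hr, -⟩ := hr hr0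
    refine ⟨fun k => ?_, fun _ => ?_⟩
    · rw [coeff_mul]
      exact Finset.sum_nonneg fun x _ => mul_nonneg (hq _) (hr _)
    · rw [mul_coeff_one]
      have := mul_nonneg hq0.le (hr 1)
      have := mul_pos hq1 hr0
      linarith
  refine HurwitzStable.induction (P := fun p => 0 < p.coeff 0 →
    (∀ k, 0 ≤ p.coeff k) ∧ (p.natDegree ≠ 0 → 0 < p.coeff 1)) ?_ ?_ ?_ hp h0
  · intro c _ h0
    refine ⟨fun k => ?_, fun h => absurd (natDegree_C c) h⟩
    rw [coeff_C_zero] at h0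
    rw [coeff_C]
    split_ifs
    exacts [h0.le, le_rfl]
  · intro a q ha ih h0
    refine mul _ _ (fun k => ?_) (by simpa using ha) (by simp [coeff_X]) ih h0
    rw [coeff_add, coeff_X, coeff_C]
    split_ifs <;> linarith
  · intro b c q hb hc ih h0
    refine mul _ _ (fun k => ?_) (by simpa using hc) (by simpa [coeff_X, coeff_C] using hb) ih h0
    rw [coeff_add, coeff_add, coeff_X_pow, coeff_C_mul, coeff_X, coeff_C]
    split_ifs <;> simp <;> linarith

theorem norm_aeval_eq_prod_aroots (p : ℝ[X]) (w : ℂ) :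
    ‖aeval w p‖ = |p.leadingCoeff| * ((p.aroots ℂ).map fun a => ‖w - a‖).prod := by
  rw [(IsAlgClosed.splits _).aeval_eq_prod_aroots, norm_mul, Complex.coe_algebraMap,
    Complex.norm_real, Real.norm_eq_abs]
  congr 1
  exact (map_multiset_prod (normHom : ℂ →*₀ ℝ) _).trans (by rw [Multiset.map_map]; rfl)

/-- The reflection `w ↦ -conj w` in the imaginary axis brings a point of the right half plane
closer to each zero of a stable polynomial, and `p (-conj w)` is conjugate to `p (-w)`. -/
theorem HurwitzStable.norm_aeval_neg_lt {p : ℝ[X]} (hp : HurwitzStable p)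
    (hd : p.natDegree ≠ 0) {w : ℂ} (hw : 0 < w.re) : ‖aeval (-w) p‖ < ‖aeval w p‖ := by
  have hconj : ‖aeval (-w) p‖ = ‖aeval (-(starRingEnd ℂ w)) p‖ := by
    rw [← map_neg, aeval_conj, Complex.norm_conj]
  have hroots : ∀ a ∈ p.aroots ℂ, a.re < 0 := fun a ha => hp a (mem_aroots.1 ha).2
  have hdist : ∀ a ∈ p.aroots ℂ, ‖-(starRingEnd ℂ w) - a‖ < ‖w - a‖ := by
    intro a ha
    have := hroots a ha
    rw [Complex.norm_def, Complex.norm_def]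
    refine Real.sqrt_lt_sqrt (Complex.normSq_nonneg _) ?_
    simp only [Complex.normSq_apply, Complex.sub_re, Complex.neg_re, Complex.conj_re,
      Complex.sub_im, Complex.neg_im, Complex.conj_im]
    nlinarith
  by_cases hv : aeval (-(starRingEnd ℂ w)) p = 0
  · rw [hconj, hv, norm_zero]
    exact norm_pos_iff.2 fun h => absurd (hp w h) (not_lt.2 hw.le)
  rw [hconj, norm_aeval_eq_prod_aroots, norm_aeval_eq_prod_aroots]
  refine mul_lt_mul_of_pos_left (Multiset.prod_map_lt_prod_map ?_ _ _ (fun a ha => ?_) hdist)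
    (abs_pos.2 (leadingCoeff_ne_zero.2 hp.ne_zero))
  · obtain ⟨a, ha⟩ := IsAlgClosed.exists_aeval_eq_zero ℂ p
      (fun h => hd (natDegree_eq_zero_iff_degree_le_zero.2 h.le))
    exact fun h => Multiset.notMem_zero a (h ▸ mem_aroots.2 ⟨hp.ne_zero, ha⟩)
  · refine norm_pos_iff.2 fun h => hv ?_
    rw [sub_eq_zero.1 h]
    exact (mem_aroots.1 ha).2

/-- The polynomial `E` with `p = E (X ^ 2) + X * O (X ^ 2)`. -/
noncomputable def evenPart (p : ℝ[X]) : ℝ[X] := contract 2 p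

/-- The polynomial `O` with `p = E (X ^ 2) + X * O (X ^ 2)`. -/
noncomputable def oddPart (p : ℝ[X]) : ℝ[X] := contract 2 (divX p)

theorem coeff_evenPart (p : ℝ[X]) (k : ℕ) : (evenPart p).coeff k = p.coeff (k * 2) :=
  coeff_contract two_ne_zero _ _

theorem coeff_oddPart (p : ℝ[X]) (k : ℕ) : (oddPart p).coeff k = p.coeff (k * 2 + 1) := by
  rw [oddPart, coeff_contract two_ne_zero, coeff_divX]

theorem expand_evenPart_add_expand_oddPart (p : ℝ[X]) :
    expand ℝ 2 (evenPart p) + X * expand ℝ 2 (oddPart p) = p := by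
  ext n
  rw [coeff_add, coeff_expand two_pos, coeff_evenPart]
  cases n with
  | zero => simp
  | succ n =>
    rw [coeff_X_mul, coeff_expand two_pos, coeff_oddPart]
    by_cases h : 2 ∣ n
    · rw [if_neg (by omega), if_pos h, zero_add, Nat.div_mul_cancel h]
    · rw [if_pos (by omega), if_neg h, add_zero, Nat.div_mul_cancel (by omega)]

theorem aeval_eq_evenPart_add_oddPart (p : ℝ[X]) (w : ℂ) :
    aeval w p = aeval (w ^ 2) (evenPart p) + w * aeval (w ^ 2) (oddPart p) := by
  conv_lhs => rw [← expand_evenPart_add_expand_oddPart p]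
  simp only [map_add, map_mul, expand_aeval, aeval_X]

theorem negRooted_of_aeval_sq_ne_zero {q : ℝ[X]} (h0 : q.coeff 0 ≠ 0)
    (hq : ∀ w : ℂ, 0 < w.re → aeval (w ^ 2) q ≠ 0) : NegRooted q := by
  intro u hu
  have hu0 : u ≠ 0 := by
    rintro rfl
    rw [← coeff_zero_eq_aeval_zero'] at hu
    exact h0 (by simpa using hu)
  obtain ⟨w, rfl⟩ := IsAlgClosed.exists_pow_nat_eq u two_pos
  have hre : w.re = 0 := by
    rcases lt_trichotomy w.re 0 with h | h | h
    · exact absurd (by rwa [neg_sq]) (hq (-w) (by simpa using h))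
    · exact h
    · exact absurd hu (hq w h)
  have him : w.im ≠ 0 := fun h => hu0 (by rw [Complex.ext (z := w) (w := 0) hre h]; simp)
  rw [sq, Complex.mul_im, Complex.mul_re, hre]
  have := mul_self_pos.2 him
  constructor
  · ring
  · linarith

/-- Hermite-Biehler for the even part: a zero `w ^ 2` of the even part with `0 < re w` would give
`p (-w) = -p w`. -/
theorem HurwitzStable.negRooted_evenPart {p : ℝ[X]} (hp : HurwitzStable p) :
    NegRooted (evenPart p) := by
  have h0 : p.coeff 0 ≠ 0 := fun h => by
    have := hp 0 (by rw [← coeff_zero_eq_aeval_zero', h, map_zero])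
    simp at this
  refine negRooted_of_aeval_sq_ne_zero (by rwa [coeff_evenPart]) fun w hw h => ?_
  have h1 := aeval_eq_evenPart_add_oddPart p w
  have h2 := aeval_eq_evenPart_add_oddPart p (-w)
  rw [neg_sq] at h2
  rw [h, zero_add] at h1 h2
  by_cases hd : p.natDegree = 0
  · rw [eq_C_of_natDegree_eq_zero hd, evenPart, contract_C, aeval_C] at h
    exact h0 (by simpa using h)
  · refine absurd (hp.norm_aeval_neg_lt hd hw) (not_lt.2 (le_of_eq ?_))
    rw [h1, h2, neg_mul, norm_neg]

/-- Hermite-Biehler for the odd part, which vanishes only if the polynomial is constant. -/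
theorem HurwitzStable.negRooted_oddPart {p : ℝ[X]} (hp : HurwitzStable p) :
    oddPart p = 0 ∨ NegRooted (oddPart p) := by
  by_cases hd : p.natDegree = 0
  · left
    ext k
    rw [coeff_oddPart, coeff_zero]
    exact coeff_eq_zero_of_natDegree_lt (by omega)
  right
  have h0 : p.coeff 0 ≠ 0 := fun h => by
    have := hp 0 (by rw [← coeff_zero_eq_aeval_zero', h, map_zero])
    simp at this
  have h1 : p.coeff 1 ≠ 0 := by
    rcases h0.lt_or_gt with h | h
    · have hn : HurwitzStable (-p) := fun w hw => hp w (by simpa using hw)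
      have := (hn.coeff_nonneg (by simpa using h)).2 (by rwa [natDegree_neg])
      rw [coeff_neg] at this
      linarith
    · exact ((hp.coeff_nonneg h).2 hd).ne'
  refine negRooted_of_aeval_sq_ne_zero (by rwa [coeff_oddPart]) fun w hw h => ?_
  have h1 := aeval_eq_evenPart_add_oddPart p w
  have h2 := aeval_eq_evenPart_add_oddPart p (-w)
  rw [neg_sq] at h2
  rw [h, mul_zero, add_zero] at h1 h2
  refine absurd (hp.norm_aeval_neg_lt hd hw) (not_lt.2 (le_of_eq ?_))
  rw [h1, h2]

/-- The polynomials `Q_s`, `s < 4`, with `p = ∑ s < 4, X ^ s * Q_s (X ^ 4)`; for other `s` the value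
is the one for `s = 3`. -/
noncomputable def quarterPart (p : ℝ[X]) : ℕ → ℝ[X]
  | 0 => evenPart (evenPart p)
  | 1 => evenPart (oddPart p)
  | 2 => oddPart (evenPart p)
  | _ => oddPart (oddPart p)

theorem coeff_zero_quarterPart (p : ℝ[X]) {s : ℕ} (hs : s < 4) :
    (quarterPart p s).coeff 0 = p.coeff s := by
  interval_cases s <;> simp [quarterPart, coeff_evenPart, coeff_oddPart]

theorem HurwitzStable.negRooted_quarterPart {p : ℝ[X]} (hp : HurwitzStable p) {s : ℕ}
    (hs : s < 4) : quarterPart p s = 0 ∨ NegRooted (quarterPart p s) := by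
  have he := hp.negRooted_evenPart.hurwitzStable
  interval_cases s
  · exact .inr he.negRooted_evenPart
  · refine hp.negRooted_oddPart.imp (fun h => ?_) fun h => h.hurwitzStable.negRooted_evenPart
    rw [quarterPart, h]
    ext k
    simp [coeff_evenPart]
  · exact he.negRooted_oddPart
  · rcases hp.negRooted_oddPart with h | h
    · left
      ext k
      simp [quarterPart, h, coeff_oddPart]
    · exact h.hurwitzStable.negRooted_oddPart

theorem pow_mul_aeval_quarterPart (p : ℝ[X]) {s : ℕ} (hs : s < 4) (w : ℂ) :
    w ^ s * aeval (w ^ 4) (quarterPart p s) =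
      1 / 4 * ∑ k ∈ Finset.range 4, (Complex.I ^ k) ^ (3 * s) * aeval (Complex.I ^ k * w) p := by
  have key : ∀ v : ℂ, aeval v p = (aeval (v ^ 4) (quarterPart p 0) +
      v ^ 2 * aeval (v ^ 4) (quarterPart p 2)) + v * (aeval (v ^ 4) (quarterPart p 1) +
      v ^ 2 * aeval (v ^ 4) (quarterPart p 3)) := by
    intro v
    rw [aeval_eq_evenPart_add_oddPart p v, aeval_eq_evenPart_add_oddPart (evenPart p),
      aeval_eq_evenPart_add_oddPart (oddPart p), ← pow_mul]
    rfl
  have h4 : ∀ k, (Complex.I ^ k * w) ^ 4 = w ^ 4 := fun k => by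
    rw [mul_pow, ← pow_mul, mul_comm k 4, pow_mul, Complex.I_pow_four, one_pow, one_mul]
  simp only [key, h4, Finset.sum_range_succ, Finset.sum_range_zero]
  have e2 : Complex.I ^ 2 = -1 := Complex.I_sq
  have e3 : Complex.I ^ 3 = -Complex.I := by rw [pow_succ, e2]; ring
  interval_cases s <;>
    simp only [mul_pow, e2, e3, pow_zero, pow_one, mul_zero, one_mul, one_pow] <;>
    ring_nf <;> simp [pow_succ, Complex.I_mul_I] <;> ring

end Polynomials

/-! ### Lower bounds for polynomials with negative zeros -/

section LowerBounds

open Polynomial Filter Topology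

/-- The bound for a single zero `-τ`: both sides agree to leading order as `τ → ∞`, and a large `K`
compensates for the first order loss in `‖u + τ‖` when `re u` is negative. -/
theorem exists_pow_le_norm_add_mul_pow {u : ℂ} (hu : ¬(u.im = 0 ∧ u.re ≤ 0)) :
    ∃ K : ℕ, ∀ τ : ℝ, 0 < τ → τ ^ (K + 1) ≤ ‖u + τ‖ * (‖u‖ + τ) ^ K := by
  set x := ‖u‖ with hx
  have hsq : x ^ 2 = u.re ^ 2 + u.im ^ 2 := by
    rw [hx, Complex.sq_norm, Complex.normSq_apply]; ring
  have hxle : u.re ≤ x := Complex.re_le_norm u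
  have hx0 : 0 < x := norm_pos_iff.2 (by rintro rfl; simp at hu)
  have hpos : 0 < x + u.re := by
    by_contra h
    refine hu ⟨?_, by linarith⟩
    have : u.im ^ 2 ≤ 0 := by nlinarith
    exact pow_eq_zero_iff two_ne_zero |>.1 (le_antisymm this (sq_nonneg _))
  obtain ⟨K, hK⟩ := exists_nat_ge (4 * x / (x + u.re))
  rw [div_le_iff₀ hpos] at hK
  refine ⟨K, fun τ hτ => ?_⟩
  have hN : ‖u + τ‖ ^ 2 = x ^ 2 + 2 * τ * u.re + τ ^ 2 := by
    rw [Complex.sq_norm, Complex.normSq_apply, hsq]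
    simp
    ring
  refine le_of_sq_le_sq ?_ (by positivity)
  rw [mul_pow, hN, ← pow_mul, ← pow_mul]
  set N := x ^ 2 + 2 * τ * u.re + τ ^ 2 with hNdef
  have hN0 : 0 ≤ N := hN ▸ sq_nonneg _
  have hδ : (x + u.re) * (x + τ) ^ 2 ≤ 2 * x * N := by
    have : 0 ≤ (x - u.re) * (x - τ) ^ 2 := mul_nonneg (by linarith) (sq_nonneg _)
    rw [hNdef]
    nlinarith
  -- Bernoulli's inequality reduces the claim to a cubic inequality in `τ`.
  have hB : τ ^ (K * 2) * (τ + (K * 2) * x) ≤ (x + τ) ^ (K * 2) * τ := by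
    have h := one_add_mul_le_pow (a := x / τ) (by have := div_pos hx0 hτ; linarith) (K * 2)
    have e : x + τ = τ * (1 + x / τ) := by field_simp; ring
    rw [e, mul_pow]
    push_cast at h
    calc τ ^ (K * 2) * (τ + (K * 2) * x) = τ ^ (K * 2) * (1 + (K * 2) * (x / τ)) * τ := by
          field_simp
      _ ≤ _ := by gcongr
  have hcubic : τ ^ 3 ≤ (τ + (K * 2) * x) * N := by
    have h1 : (K : ℝ) * ((x + u.re) * (x + τ) ^ 2) ≤ K * (2 * x * N) := by gcongr
    have h2 : 4 * x * (x + τ) ^ 2 ≤ K * (x + u.re) * (x + τ) ^ 2 := by gcongr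
    have h3 : τ * N = τ ^ 3 + 2 * u.re * τ ^ 2 + x ^ 2 * τ := by rw [hNdef]; ring
    have h4 : 0 ≤ (x + u.re) * τ ^ 2 := by positivity
    have h5 : 0 < x * τ ^ 2 := by positivity
    have h6 : 0 < x ^ 2 * τ := by positivity
    have h7 : 0 < x ^ 3 := by positivity
    nlinarith
  refine le_of_mul_le_mul_right ?_ hτ
  calc τ ^ ((K + 1) * 2) * τ = τ ^ (K * 2) * τ ^ 3 := by ring
    _ ≤ τ ^ (K * 2) * ((τ + (K * 2) * x) * N) := by gcongr
    _ = τ ^ (K * 2) * (τ + (K * 2) * x) * N := by ring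
    _ ≤ (x + τ) ^ (K * 2) * τ * N := by gcongr
    _ = N * (x + τ) ^ (K * 2) * τ := by ring

/-- Off the closed negative axis, the modulus of a polynomial with negative zeros is bounded below
in terms of its constant term and its value at a positive point, independently of its degree. -/
theorem exists_abs_coeff_zero_pow_le {u : ℂ} (hu : ¬(u.im = 0 ∧ u.re ≤ 0)) :
    ∃ K : ℕ, ∀ q : ℝ[X], NegRooted q →
      |q.coeff 0| ^ (K + 1) ≤ ‖aeval u q‖ * ‖aeval (‖u‖ : ℂ) q‖ ^ K := by
  obtain ⟨K, hK⟩ := exists_pow_le_norm_add_mul_pow hu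
  refine ⟨K, fun q hq => ?_⟩
  have h0 : |q.coeff 0| = ‖aeval (0 : ℂ) q‖ := by
    rw [← coeff_zero_eq_aeval_zero', Complex.coe_algebraMap, Complex.norm_real, Real.norm_eq_abs]
  rw [h0, norm_aeval_eq_prod_aroots, norm_aeval_eq_prod_aroots, norm_aeval_eq_prod_aroots,
    mul_pow, mul_pow, mul_mul_mul_comm, ← pow_succ', ← Multiset.prod_map_pow,
    ← Multiset.prod_map_pow, ← Multiset.prod_map_mul]
  gcongr
  refine Multiset.prod_map_le_prod_map₀ _ _ (fun _ _ => by positivity) fun a ha => ?_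
  obtain ⟨him, hre⟩ := hq a (mem_aroots.1 ha).2
  obtain ⟨τ, rfl⟩ : ∃ τ : ℝ, a = -(τ : ℂ) :=
    ⟨-a.re, Complex.ext (by simp) (by simp [him])⟩
  have hτ : 0 < τ := by simpa using hre
  have e : ‖(‖u‖ : ℂ) + τ‖ = ‖u‖ + τ := by
    rw [← Complex.ofReal_add, Complex.norm_real, Real.norm_of_nonneg (by positivity)]
  simp only [sub_neg_eq_add, zero_add, e, Complex.norm_real, Real.norm_of_nonneg hτ.le]
  exact hK τ hτ

/-- The combination of the values of `g` at the points `i ^ k * w` which extracts the terms of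
degree `≡ s (mod 4)` from a power series. -/
noncomputable def rotationSum (g : ℂ → ℂ) (s : ℕ) (w : ℂ) : ℂ :=
  1 / 4 * ∑ k ∈ Finset.range 4, (Complex.I ^ k) ^ (3 * s) * g (Complex.I ^ k * w)

/-- A replacement for Hurwitz's theorem on zeros of limits: the lower bound for polynomials with
negative zeros survives a pointwise limit. -/
theorem rotationSum_ne_zero_of_tendsto {P : ℕ → ℝ[X]} (hP : ∀ n, HurwitzStable (P n))
    {g : ℂ → ℂ} (hg : ∀ w, Tendsto (fun n => aeval w (P n)) atTop (𝓝 (g w)))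
    {s : ℕ} (hs : s < 4) {c : ℝ} (hc : 0 < c) (hcoeff : ∀ᶠ n in atTop, c ≤ (P n).coeff s)
    {w : ℂ} (hw : ¬((w ^ 4).im = 0 ∧ (w ^ 4).re ≤ 0)) : rotationSum g s w ≠ 0 := by
  have hw0 : 0 < ‖w‖ := norm_pos_iff.2 (by rintro rfl; simp at hw)
  have hlim : ∀ v, Tendsto (fun n => v ^ s * aeval (v ^ 4) (quarterPart (P n) s)) atTop
      (𝓝 (rotationSum g s v)) := by
    intro v
    simp only [pow_mul_aeval_quarterPart _ hs]
    exact (tendsto_finsetSum _ fun k _ => (hg _).const_mul _).const_mul _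
  obtain ⟨K, hK⟩ := exists_abs_coeff_zero_pow_le hw
  have hbound : (‖w‖ ^ s * c) ^ (K + 1) ≤
      ‖rotationSum g s w‖ * ‖rotationSum g s (‖w‖ : ℂ)‖ ^ K := by
    refine ge_of_tendsto (((hlim w).norm).mul ((hlim (‖w‖ : ℂ)).norm.pow K)) ?_
    filter_upwards [hcoeff] with n hn
    have hQ0 : (quarterPart (P n) s).coeff 0 = (P n).coeff s := coeff_zero_quarterPart _ hs
    have hQ : NegRooted (quarterPart (P n) s) :=
      ((hP n).negRooted_quarterPart hs).resolve_left fun h => by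
        rw [h, coeff_zero] at hQ0
        linarith
    have h := hK _ hQ
    rw [hQ0, abs_of_pos (hc.trans_le hn), norm_pow, Complex.ofReal_pow] at h
    calc (‖w‖ ^ s * c) ^ (K + 1) ≤ (‖w‖ ^ s * (P n).coeff s) ^ (K + 1) := by gcongr
      _ = (‖w‖ ^ s) ^ (K + 1) * (P n).coeff s ^ (K + 1) := mul_pow _ _ _
      _ ≤ (‖w‖ ^ s) ^ (K + 1) * (‖aeval (w ^ 4) (quarterPart (P n) s)‖ *
          ‖aeval ((‖w‖ : ℂ) ^ 4) (quarterPart (P n) s)‖ ^ K) := by gcongr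
      _ = _ := by
        rw [norm_mul, norm_mul, norm_pow, norm_pow, Complex.norm_real, norm_norm]
        ring
  intro h
  rw [h, norm_zero, zero_mul] at hbound
  have : 0 < (‖w‖ ^ s * c) ^ (K + 1) := by positivity
  linarith

end LowerBounds

/-! ### Canonical products with conjugate symmetric zeros -/

section CanonicalProduct

open Polynomial Filter Topology

variable {ι : Type*} {z : ι → ℂ}

theorem finite_setOf_norm_le (hz : ∀ j, z j ≠ 0) (hsum : Summable fun j => 1 / ‖z j‖) (R : ℝ) :
    {j | ‖z j‖ ≤ R}.Finite := by
  by_cases hR : 0 < R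
  · have h := hsum.tendsto_cofinite_zero.eventually (gt_mem_nhds (one_div_pos.2 hR))
    refine (eventually_cofinite.1 h).subset fun j hj => ?_
    exact not_lt.2 (one_div_le_one_div_of_le (norm_pos_iff.2 (hz j)) hj)
  · convert! Set.finite_empty
    ext j
    simp only [Set.mem_ofPred_eq, Set.mem_empty_iff_false, iff_false, not_le]
    exact (not_lt.1 hR).trans_lt (norm_pos_iff.2 (hz j))

theorem summable_norm_div_zeros (hsum : Summable fun j => 1 / ‖z j‖) (w : ℂ) :
    Summable fun j => ‖-(w / z j)‖ := by
  refine (hsum.mul_left ‖w‖).congr fun j => ?_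
  rw [norm_neg, norm_div, mul_one_div]

theorem multipliable_one_sub_div (hsum : Summable fun j => 1 / ‖z j‖) (w : ℂ) :
    Multipliable fun j => 1 - w / z j := by
  simpa only [sub_eq_add_neg] using multipliable_one_add_of_summable (summable_norm_div_zeros hsum w)

/-- The convergence factors of a product of genus one can be collected into one exponential when
the reciprocals of the zeros are summable. -/
theorem tprod_one_sub_div_mul_exp (hsum : Summable fun j => 1 / ‖z j‖) (w : ℂ) :
    ∏' j, ((1 - w / z j) * Complex.exp (w / z j)) =
      (∏' j, (1 - w / z j)) * Complex.exp (w * ∑' j, 1 / z j) := by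
  have hs : Summable fun j => 1 / z j := Summable.of_norm (by simpa using hsum)
  have h : HasProd (fun j => Complex.exp (w / z j)) (Complex.exp (w * ∑' j, 1 / z j)) := by
    have := (hs.hasSum.mul_left w).cexp
    simpa only [Function.comp_def, mul_one_div] using this
  rw [(multipliable_one_sub_div hsum w).tprod_mul h.multipliable, h.tprod_eq]

/-- Splitting off the factors of the canonical product which vanish at `ζ`. -/
theorem exists_tprod_eq_pow_mul (hz : ∀ j, z j ≠ 0) (hsum : Summable fun j => 1 / ‖z j‖)
    (ζ : ℂ) : ∃ h : ℂ → ℂ, ContinuousAt h ζ ∧ h ζ ≠ 0 ∧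
      ∀ w, ∏' j, (1 - w / z j) = (1 - w / ζ) ^ {j | z j = ζ}.ncard * h w := by
  classical
  let F : ι → ℂ → ℂ := fun j w => if z j = ζ then 0 else -(w / z j)
  have hFle : ∀ j w, ‖F j w‖ ≤ ‖w‖ * (1 / ‖z j‖) := by
    intro j w
    simp only [F]
    split_ifs
    · rw [norm_zero]; positivity
    · rw [norm_neg, norm_div, mul_one_div]
  have hFs : ∀ w, Summable fun j => ‖F j w‖ := fun w =>
    (hsum.mul_left ‖w‖).of_nonneg_of_le (fun _ => norm_nonneg _) fun j => hFle j w
  refine ⟨fun w => ∏' j, (1 + F j w), ?_, ?_, fun w => ?_⟩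
  · have hK : ζ ∈ Metric.ball (0 : ℂ) (‖ζ‖ + 1) := by simp
    have hlu := Summable.hasProdLocallyUniformlyOn_one_add (f := F) (Metric.isOpen_ball)
      (hsum.mul_left (‖ζ‖ + 1)) (K := Metric.ball (0 : ℂ) (‖ζ‖ + 1))
      (.of_forall fun j w hw => (hFle j w).trans (by
        have : ‖w‖ < ‖ζ‖ + 1 := by simpa using hw
        gcongr))
      (fun j => by
        simp only [F]
        split_ifs
        · exact continuousOn_const
        · fun_prop)
    refine ContinuousOn.continuousAt ?_ (Metric.isOpen_ball.mem_nhds hK)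
    refine (hasProdLocallyUniformlyOn_iff_tendstoLocallyUniformlyOn.1 hlu).continuousOn
      (Frequently.of_forall fun s => continuousOn_finsetProd _ fun j _ => ?_)
    simp only [F]
    split_ifs
    · fun_prop
    · fun_prop
  · refine tprod_one_add_ne_zero_of_summable (fun j => ?_) (hFs ζ)
    simp only [F]
    split_ifs with h
    · simp
    · rw [← sub_eq_add_neg, sub_ne_zero]
      exact fun h' => h ((div_eq_one_iff_eq (hz j)).1 h'.symm).symm
  · have hfin : {j | z j = ζ}.Finite :=
      (finite_setOf_norm_le hz hsum ‖ζ‖).subset fun j hj => by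
        rw [Set.mem_ofPred_eq] at hj ⊢; rw [hj]
    have hone : ∀ j ∉ hfin.toFinset, (if z j = ζ then 1 - w / ζ else 1) = 1 := fun j hj =>
      if_neg (by simpa using hj)
    have h1 : ∏' j, (if z j = ζ then 1 - w / ζ else 1) = (1 - w / ζ) ^ {j | z j = ζ}.ncard := by
      rw [tprod_eq_prod hone, Set.ncard_eq_toFinset_card _ hfin]
      exact Finset.prod_eq_pow_card fun j hj => if_pos (by simpa using hj)
    rw [← h1, ← Multipliable.tprod_mul (multipliable_of_ne_finset_one hone)
      (multipliable_one_add_of_summable (hFs w))]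
    refine tprod_congr fun j => ?_
    simp only [F]
    split_ifs with h
    · rw [h]; ring
    · ring

/-- If a real function is a canonical product up to a factor without zeros, then each number occurs
among the zeros as often as its conjugate. -/
theorem ncard_zeros_eq_ncard_zeros_conj (hz : ∀ j, z j ≠ 0)
    (hsum : Summable fun j => 1 / ‖z j‖) {f G : ℂ → ℂ}
    (hreal : ∀ w, f (starRingEnd ℂ w) = starRingEnd ℂ (f w)) (hG : Continuous G)
    (hG0 : ∀ w, w ≠ 0 → G w ≠ 0) (hf : ∀ w, f w = G w * ∏' j, (1 - w / z j)) {ζ : ℂ}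
    (hζ : ζ ≠ 0) : {j | z j = ζ}.ncard = {j | z j = starRingEnd ℂ ζ}.ncard := by
  suffices hle : ∀ ζ : ℂ, ζ ≠ 0 → {j | z j = starRingEnd ℂ ζ}.ncard ≤ {j | z j = ζ}.ncard by
    refine le_antisymm ?_ (hle ζ hζ)
    simpa using hle (starRingEnd ℂ ζ) (by simpa using hζ)
  intro ζ hζ
  by_contra! hlt
  obtain ⟨h, hc, h0, hh⟩ := exists_tprod_eq_pow_mul hz hsum ζ
  obtain ⟨h', hc', -, hh'⟩ := exists_tprod_eq_pow_mul hz hsum (starRingEnd ℂ ζ)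
  obtain ⟨d, hd⟩ := Nat.exists_eq_add_of_lt hlt
  -- Cancelling the smaller power of `1 - w / ζ` exhibits `G ζ * h ζ` as a limit of values which
  -- still contain this factor.
  let k : ℂ → ℂ := fun w => starRingEnd ℂ (G (starRingEnd ℂ w) * h' (starRingEnd ℂ w))
  have hk : ContinuousAt k ζ := by
    have hconj : ContinuousAt (starRingEnd ℂ) ζ := Complex.continuous_conj.continuousAt
    exact Complex.continuous_conj.continuousAt.comp
      ((hG.continuousAt.comp hconj).mul (ContinuousAt.comp (g := h') hc' hconj))
  have heq : ∀ w, w ≠ ζ → G w * h w = (1 - w / ζ) ^ (d + 1) * k w := by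
    intro w hw
    have hne : 1 - w / ζ ≠ 0 := sub_ne_zero.2 fun e => hw ((div_eq_one_iff_eq hζ).1 e.symm)
    have e1 : f w = G w * ((1 - w / ζ) ^ {j | z j = ζ}.ncard * h w) := by rw [hf, hh]
    have e2 : f w = (1 - w / ζ) ^ {j | z j = starRingEnd ℂ ζ}.ncard * k w := by
      have := hreal (starRingEnd ℂ w)
      rw [Complex.conj_conj] at this
      rw [this, hf, hh']
      simp only [k, map_mul, map_pow, map_sub, map_div₀, map_one, Complex.conj_conj]
      ring
    refine mul_left_cancel₀ (pow_ne_zero {j | z j = ζ}.ncard hne) ?_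
    rw [mul_left_comm, ← e1, e2, hd]
    ring
  have hl : Tendsto (fun w => G w * h w) (𝓝[≠] ζ) (𝓝 (G ζ * h ζ)) :=
    (hG.continuousAt.mul hc).tendsto.mono_left nhdsWithin_le_nhds
  have hr : Tendsto (fun w => (1 - w / ζ) ^ (d + 1) * k w) (𝓝[≠] ζ)
      (𝓝 ((1 - ζ / ζ) ^ (d + 1) * k ζ)) :=
    (ContinuousAt.mul (by fun_prop) hk).tendsto.mono_left nhdsWithin_le_nhds
  have := tendsto_nhds_unique hl
    (hr.congr' (by filter_upwards [self_mem_nhdsWithin] with w hw using (heq w hw).symm))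
  rw [div_self hζ, sub_self, zero_pow d.succ_ne_zero, zero_mul] at this
  exact mul_ne_zero (hG0 ζ hζ) h0 this

/-- Partial products over the zeros in a disc centred at `0` are real polynomials when the zeros
are symmetric. -/
theorem exists_aeval_eq_prod_one_sub_div (hz : ∀ j, z j ≠ 0)
    (hsum : Summable fun j => 1 / ‖z j‖)
    (hsymm : ∀ ζ : ℂ, ζ ≠ 0 → {j | z j = ζ}.ncard = {j | z j = starRingEnd ℂ ζ}.ncard) (R : ℝ) :
    ∃ q : ℝ[X], ∀ w : ℂ,
      aeval w q = ∏ j ∈ (finite_setOf_norm_le hz hsum R).toFinset, (1 - w / z j) := by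
  classical
  set S := (finite_setOf_norm_le hz hsum R).toFinset with hS
  have hmem : ∀ j, j ∈ S ↔ ‖z j‖ ≤ R := fun j => by simp [hS]
  let φ : ℂ → ℂ[X] := fun ζ => 1 - C (1 / ζ) * X
  have hφ : ∀ ζ, (φ ζ).map (starRingEnd ℂ) = φ (starRingEnd ℂ ζ) := fun ζ => by
    simp [φ, Polynomial.map_sub]
  have hcard : ∀ ζ ∈ S.image z, (S.filter fun j => z j = ζ).card = {j | z j = ζ}.ncard := by
    intro ζ hζ
    obtain ⟨i, hi, rfl⟩ := Finset.mem_image.1 hζ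
    rw [← Set.ncard_coe_finset]
    congr 1
    ext j
    simp only [Finset.coe_filter, Set.mem_ofPred_eq, and_iff_right_iff_imp]
    intro h
    rw [hmem, h]
    exact (hmem i).1 hi
  have hconj : ∀ ζ ∈ S.image z, starRingEnd ℂ ζ ∈ S.image z := by
    intro ζ hζ
    obtain ⟨i, hi, rfl⟩ := Finset.mem_image.1 hζ
    have h := hsymm (z i) (hz i)
    rw [← hcard _ hζ] at h
    have hpos : 0 < (S.filter fun j => z j = z i).card :=
      Finset.card_pos.2 ⟨i, Finset.mem_filter.2 ⟨hi, rfl⟩⟩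
    rw [h] at hpos
    obtain ⟨j, hj⟩ := Set.nonempty_of_ncard_ne_zero hpos.ne'
    refine Finset.mem_image.2 ⟨j, (hmem j).2 ?_, hj⟩
    rw [hj, Complex.norm_conj]
    exact (hmem i).1 hi
  have hmap : (∏ j ∈ S, φ (z j)).map (starRingEnd ℂ) = ∏ j ∈ S, φ (z j) := by
    rw [Finset.prod_comp φ z, Polynomial.map_prod]
    refine Finset.prod_nbij' (starRingEnd ℂ) (starRingEnd ℂ) hconj hconj (by simp) (by simp)
      fun ζ hζ => ?_
    rw [Polynomial.map_pow, hφ, hcard ζ hζ, hcard _ (hconj ζ hζ), hsymm]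
    obtain ⟨i, -, rfl⟩ := Finset.mem_image.1 hζ
    exact hz i
  have hlift : ∏ j ∈ S, φ (z j) ∈ lifts (algebraMap ℝ ℂ) := by
    rw [lifts_iff_coeff_lifts]
    intro n
    have h := congrArg (fun q => q.coeff n) hmap
    simp only [coeff_map] at h
    obtain ⟨r, hr⟩ := Complex.conj_eq_iff_real.1 h
    exact ⟨r, hr.symm⟩
  obtain ⟨q, hq⟩ := hlift
  refine ⟨q, fun w => ?_⟩
  rw [aeval_def, eval₂_eq_eval_map, ← coe_mapRingHom, hq, eval_prod]
  refine Finset.prod_congr rfl fun j _ => ?_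
  simp only [φ, eval_sub, eval_one, eval_mul, eval_C, eval_X]
  ring

theorem tendsto_prod_norm_le_one_sub_div (hz : ∀ j, z j ≠ 0)
    (hsum : Summable fun j => 1 / ‖z j‖) (w : ℂ) :
    Tendsto (fun n : ℕ => ∏ j ∈ (finite_setOf_norm_le hz hsum n).toFinset, (1 - w / z j)) atTop
      (𝓝 (∏' j, (1 - w / z j))) := by
  refine (multipliable_one_sub_div hsum w).hasProd.comp
    (tendsto_atTop_finset_of_monotone (fun m n hmn => ?_) fun j => ?_)
  · refine Set.Finite.toFinset_subset_toFinset.2 fun j hj => ?_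
    have : (m : ℝ) ≤ n := by exact_mod_cast hmn
    exact le_trans hj this
  · obtain ⟨n, hn⟩ := exists_nat_ge ‖z j‖
    exact ⟨n, by simpa using hn⟩

end CanonicalProduct

/-! ### Approximation by stable polynomials -/

section Approximation

open Polynomial Filter Topology

theorem hurwitzStable_one_add_quadratic {b c : ℝ} (hb : 0 < b) (hc : 0 ≤ c) :
    HurwitzStable (1 + C b * X + C c * X ^ 2) := by
  intro w hw
  by_contra! hre
  simp only [map_add, map_mul, map_one, aeval_C, aeval_X, map_pow, Complex.coe_algebraMap] at hw
  have h1 := congrArg Complex.re hw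
  have h2 := congrArg Complex.im hw
  simp [sq] at h1 h2
  have him : w.im = 0 := by
    have : (b + 2 * c * w.re) * w.im = 0 := by linarith
    refine (mul_eq_zero.1 this).resolve_left (ne_of_gt ?_)
    positivity
  rw [him] at h1
  have := mul_nonneg hb.le hre
  have := mul_nonneg hc (mul_nonneg hre hre)
  linarith

theorem coeff_one_add_C_mul_X_pow (b : ℝ) (n s : ℕ) :
    ((1 + C b * X : ℝ[X]) ^ n).coeff s = n.choose s * b ^ s := by
  have : (1 + C b * X : ℝ[X]) ^ n = ((1 + X) ^ n).comp (C b * X) := by simp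
  rw [this, comp_C_mul_X_coeff, coeff_one_add_X_pow]

/-- The coefficients of `(1 + β X / n) ^ n` stay away from zero as `n` grows. -/
theorem le_choose_mul_div_pow {β : ℝ} (hβ : 0 ≤ β) {n s : ℕ} (hn : 2 * s ≤ n) (hn0 : 0 < n) :
    (β / 2) ^ s / s.factorial ≤ n.choose s * (β / n) ^ s := by
  have h1 : (n : ℝ) / 2 ≤ ((n + 1 - s : ℕ) : ℝ) := by
    have : n ≤ 2 * (n + 1 - s) := by omega
    have : (n : ℝ) ≤ 2 * ((n + 1 - s : ℕ) : ℝ) := by exact_mod_cast this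
    linarith
  have hn' : (0 : ℝ) < n := by exact_mod_cast hn0
  calc (β / 2) ^ s / s.factorial = (n / 2 : ℝ) ^ s / s.factorial * (β / n) ^ s := by
        rw [div_mul_eq_mul_div, ← mul_pow]
        congr 2
        field_simp
    _ ≤ ((n + 1 - s : ℕ) : ℝ) ^ s / s.factorial * (β / n) ^ s := by gcongr
    _ ≤ n.choose s * (β / n) ^ s := by
        gcongr
        exact Nat.pow_le_choose s n

/-- An exponential of a quadratic polynomial times a canonical product with symmetric zeros in the
left half plane is a limit of stable polynomials. The extra factor `(1 + β X / (2 n)) ^ n` keeps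
the low coefficients away from zero, the other coefficients being nonnegative. -/
theorem exists_hurwitzStable_tendsto {ι : Type*} {z : ι → ℂ} (hz : ∀ j, (z j).re < 0)
    (hsum : Summable fun j => 1 / ‖z j‖)
    (hsymm : ∀ ζ : ℂ, ζ ≠ 0 → {j | z j = ζ}.ncard = {j | z j = starRingEnd ℂ ζ}.ncard)
    {A β : ℝ} (hA : 0 ≤ A) (hβ : 0 < β) :
    ∃ P : ℕ → ℝ[X], (∀ n, HurwitzStable (P n)) ∧
      (∀ w, Tendsto (fun n => aeval w (P n)) atTop
        (𝓝 (Complex.exp ((A : ℂ) * w ^ 2 + β * w) * ∏' j, (1 - w / z j)))) ∧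
      ∀ s, ∃ c : ℝ, 0 < c ∧ ∀ᶠ n in atTop, c ≤ (P n).coeff s := by
  have hz0 : ∀ j, z j ≠ 0 := fun j h => by simpa [h] using hz j
  choose q hq using fun n : ℕ => exists_aeval_eq_prod_one_sub_div hz0 hsum hsymm n
  have hqs : ∀ n, HurwitzStable (q n) := by
    intro n w hw
    rw [hq, Finset.prod_eq_zero_iff] at hw
    obtain ⟨j, -, hj⟩ := hw
    rw [(div_eq_one_iff_eq (hz0 j)).1 (sub_eq_zero.1 hj).symm]
    exact hz j
  have hq0 : ∀ n, (q n).coeff 0 = 1 := by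
    intro n
    have h := hq n 0
    rw [← coeff_zero_eq_aeval_zero'] at h
    simpa using h
  let l : ℕ → ℝ[X] := fun n => (1 + C (β / 2 / (n + 1 : ℕ)) * X) ^ (n + 1)
  let m : ℕ → ℝ[X] := fun n =>
    (1 + C (β / 2 / (n + 1 : ℕ)) * X + C (A / (n + 1 : ℕ)) * X ^ 2) ^ (n + 1)
  have hpos : ∀ n : ℕ, 0 < β / 2 / ((n + 1 : ℕ) : ℝ) := fun n => by positivity
  have hls : ∀ n, HurwitzStable (l n) := fun n => by
    simpa [l] using (hurwitzStable_one_add_quadratic (hpos n) le_rfl).pow (n + 1)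
  have hms : ∀ n, HurwitzStable (m n) := fun n =>
    (hurwitzStable_one_add_quadratic (hpos n) (by positivity)).pow (n + 1)
  have hm0 : ∀ n, (m n).coeff 0 = 1 := by
    intro n
    simp [m, coeff_zero_eq_eval_zero]
  refine ⟨fun n => l n * (m n * q n), fun n => (hls n).mul ((hms n).mul (hqs n)), fun w => ?_,
    fun s => ⟨(β / 2 / 2) ^ s / s.factorial, by positivity, ?_⟩⟩
  · have hexp : ∀ t : ℂ, Tendsto (fun n : ℕ => (1 + t / (n + 1 : ℕ)) ^ (n + 1)) atTop
        (𝓝 (Complex.exp t)) := fun t =>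
      (Complex.tendsto_one_add_div_pow_exp t).comp (tendsto_add_atTop_nat 1)
    have h := (hexp (β / 2 * w)).mul ((hexp (β / 2 * w + A * w ^ 2)).mul
      (tendsto_prod_norm_le_one_sub_div hz0 hsum w))
    have he : Complex.exp ((A : ℂ) * w ^ 2 + β * w) * ∏' j, (1 - w / z j) =
        Complex.exp (β / 2 * w) * (Complex.exp (β / 2 * w + A * w ^ 2) *
          ∏' j, (1 - w / z j)) := by
      rw [← mul_assoc, ← Complex.exp_add]
      ring_nf
    rw [he]
    refine h.congr fun n => ?_
    simp only [map_mul, hq, l, m, map_pow, map_add, map_one, aeval_C, aeval_X,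
      Complex.coe_algebraMap]
    push_cast
    congr 2
    · ring
    · congr 1; ring
  · filter_upwards [eventually_ge_atTop (2 * s)] with n hn
    have hmq := (((hms n).mul (hqs n)).coeff_nonneg
      (by rw [mul_coeff_zero, hm0, hq0]; norm_num)).1
    calc (β / 2 / 2) ^ s / s.factorial
        ≤ (n + 1).choose s * (β / 2 / (n + 1 : ℕ)) ^ s :=
          le_choose_mul_div_pow (by positivity) (by omega) (by omega)
      _ = (l n).coeff s * (m n * q n).coeff 0 := by
          rw [mul_coeff_zero, hm0, hq0, coeff_one_add_C_mul_X_pow, mul_one, mul_one]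
      _ ≤ (l n * (m n * q n)).coeff s := by
          rw [coeff_mul (l n)]
          refine Finset.single_le_sum (s := Finset.HasAntidiagonal.antidiagonal s)
            (f := fun x : ℕ × ℕ => (l n).coeff x.1 * (m n * q n).coeff x.2)
            (fun x _ => mul_nonneg ?_ (hmq _)) (a := (s, 0)) (by simp)
          rw [coeff_one_add_C_mul_X_pow]
          have := hpos n
          positivity

end Approximation

/-! ### Sections of power series modulo four -/

section Sections

theorem HasSum.conj_of_real_coeff {a : ℕ → ℝ} {f : ℂ → ℂ}
    (hf : ∀ w : ℂ, HasSum (fun j : ℕ => (a j : ℂ) * w ^ j) (f w)) (w : ℂ) :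
    f (starRingEnd ℂ w) = starRingEnd ℂ (f w) := by
  refine (hf _).unique ?_
  have h := Complex.hasSum_conj'.2 (hf w)
  simpa using h

theorem differentiable_of_hasSum_pow {c : ℕ → ℂ} {f : ℂ → ℂ}
    (hf : ∀ w : ℂ, HasSum (fun j : ℕ => c j * w ^ j) (f w)) : Differentiable ℂ f := by
  have hrad : (FormalMultilinearSeries.ofScalars ℂ c).radius = ⊤ := by
    refine FormalMultilinearSeries.radius_eq_top_of_summable_norm _ fun r => ?_
    refine ((hf (r : ℝ)).summable.norm).congr fun j => ?_
    rw [FormalMultilinearSeries.ofScalars_norm, norm_mul, norm_pow, Complex.norm_real,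
      NNReal.norm_eq]
  have h : HasFPowerSeriesOnBall f (.ofScalars ℂ c) 0 ⊤ :=
    { r_le := hrad.ge
      r_pos := ENNReal.zero_lt_top
      hasSum := fun {w} _ => by
        rw [zero_add]
        simpa [FormalMultilinearSeries.ofScalars_apply_eq, mul_comm] using hf w }
  rw [← differentiableOn_univ]
  simpa using h.differentiableOn

theorem rotationSum_pow (r j : ℕ) (w : ℂ) :
    rotationSum (fun v => v ^ j) r w = if j ≡ r [MOD 4] then w ^ j else 0 := by
  have e : ∀ k, (Complex.I ^ k) ^ (3 * r) * (Complex.I ^ k * w) ^ j =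
      (Complex.I ^ ((3 * r + j) % 4)) ^ k * w ^ j := by
    intro k
    rw [← pow_eq_pow_mod _ Complex.I_pow_four, mul_pow, ← mul_assoc, ← pow_add, ← pow_mul,
      ← pow_mul, mul_comm k]
  have hmod : (j ≡ r [MOD 4]) ↔ (3 * r + j) % 4 = 0 := by
    rw [Nat.ModEq]; omega
  simp only [rotationSum, e, ← Finset.sum_mul, hmod]
  have hlt : (3 * r + j) % 4 < 4 := Nat.mod_lt _ (by norm_num)
  generalize (3 * r + j) % 4 = m at hlt
  have e2 : Complex.I ^ 2 = -1 := Complex.I_sq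
  have e3 : Complex.I ^ 3 = -Complex.I := by rw [pow_succ, e2]; ring
  interval_cases m <;> simp [Finset.sum_range_succ, e2, e3] <;> ring_nf <;> simp [e3]

theorem sectionMod_eq_rotationSum {a : ℕ → ℝ} {f : ℂ → ℂ}
    (hf : ∀ w : ℂ, HasSum (fun j : ℕ => (a j : ℂ) * w ^ j) (f w)) (r : ℕ) :
    sectionMod a 4 r = rotationSum f r := by
  funext w
  have h : HasSum (fun j => 1 / 4 * ∑ k ∈ Finset.range 4, (Complex.I ^ k) ^ (3 * r) *
      ((a j : ℂ) * (Complex.I ^ k * w) ^ j)) (rotationSum f r w) :=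
    (hasSum_sum fun k _ => (hf (Complex.I ^ k * w)).mul_left _).mul_left _
  rw [sectionMod, ← h.tsum_eq]
  refine tsum_congr fun j => ?_
  have e := rotationSum_pow r j w
  rw [← mul_ite_zero, ← e, rotationSum, mul_left_comm, Finset.mul_sum]
  simp only [mul_left_comm]

theorem Differentiable.rotationSum {f : ℂ → ℂ} (hf : Differentiable ℂ f) (r : ℕ) :
    Differentiable ℂ (rotationSum f r) := by
  unfold _root_.rotationSum
  have : ∀ k, Differentiable ℂ fun w => f (Complex.I ^ k * w) := fun k =>
    hf.comp (differentiable_id.const_mul _)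
  fun_prop

theorem rotationSum_const_mul_pow_mul (K : ℂ) (p : ℕ) (g : ℂ → ℂ) (r : ℕ) (w : ℂ) :
    rotationSum (fun v => K * v ^ p * g v) r w =
      K * w ^ p * rotationSum g ((r + 3 * p) % 4) w := by
  simp only [rotationSum, Finset.mul_sum]
  refine Finset.sum_congr rfl fun k _ => ?_
  have hk : (Complex.I ^ k) ^ 4 = 1 := by
    rw [← pow_mul, mul_comm, pow_mul, Complex.I_pow_four, one_pow]
  have e : (Complex.I ^ k) ^ (3 * r) * (Complex.I ^ k) ^ p =
      (Complex.I ^ k) ^ (3 * ((r + 3 * p) % 4)) := by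
    rw [← pow_add, pow_eq_pow_mod _ hk, pow_eq_pow_mod (3 * ((r + 3 * p) % 4)) hk]
    congr 1
    omega
  rw [← e, mul_pow]
  ring

end Sections

/-! ### Zeros of the sections of an entire function -/

theorem theorem4 {ι : Type*} [Countable ι]
    (a : ℕ → ℝ) (f : ℂ → ℂ)
    (hf : ∀ w : ℂ, HasSum (fun j : ℕ => (a j : ℂ) * w ^ j) (f w))
    (hzeros : ∀ w : ℂ, w ≠ 0 → f w = 0 → w.re < 0)
    (p : ℕ) (A : ℝ) (B C : ℂ) (z : ι → ℂ)
    (hz : ∀ j, z j ≠ 0)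
    (hfact : ∀ w : ℂ, f w = w ^ p * Complex.exp ((A : ℂ) * w ^ 2 + B * w + C) *
      ∏' j, ((1 - w / z j) * Complex.exp (w / z j)))
    (hA : 0 ≤ A)
    (hsum : Summable (fun j => 1 / ‖z j‖))
    (hB : 0 < B + ∑' j, 1 / z j)
    (r : ℕ) (hr : r < 4) :
    Differentiable ℂ (sectionMod a 4 r) ∧
      ∀ w : ℂ, sectionMod a 4 r w = 0 → (w ^ 4).im = 0 ∧ (w ^ 4).re ≤ 0 := by
  obtain ⟨β, hβ, hβeq⟩ : ∃ β : ℝ, 0 < β ∧ B + ∑' j, 1 / z j = β := by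
    obtain ⟨h1, h2⟩ := Complex.pos_iff.1 hB
    exact ⟨_, h1, Complex.ext rfl (by simpa using h2.symm)⟩
  have hG : ∀ w, f w = (w ^ p * Complex.exp C * Complex.exp ((A : ℂ) * w ^ 2 + β * w)) *
      ∏' j, (1 - w / z j) := by
    intro w
    rw [hfact, tprod_one_sub_div_mul_exp hsum, ← hβeq]
    simp only [add_mul, Complex.exp_add, mul_comm w]
    ring
  have hzre : ∀ j, (z j).re < 0 := by
    intro j
    refine hzeros _ (hz j) ?_
    have h0 : ∏' i, (1 - z j / z i) = 0 :=
      tprod_of_exists_eq_zero ⟨j, by rw [div_self (hz j), sub_self]⟩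
    rw [hG, h0, mul_zero]
  have hsymm : ∀ ζ : ℂ, ζ ≠ 0 → {j | z j = ζ}.ncard = {j | z j = starRingEnd ℂ ζ}.ncard :=
    fun ζ hζ => ncard_zeros_eq_ncard_zeros_conj hz hsum (HasSum.conj_of_real_coeff hf)
      (G := fun w => w ^ p * Complex.exp C * Complex.exp ((A : ℂ) * w ^ 2 + β * w))
      (by fun_prop) (fun w hw => mul_ne_zero (mul_ne_zero (pow_ne_zero _ hw)
        (Complex.exp_ne_zero _)) (Complex.exp_ne_zero _)) hG hζ
  obtain ⟨P, hP, hlim, hcoeff⟩ := exists_hurwitzStable_tendsto hzre hsum hsymm hA hβ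
  rw [sectionMod_eq_rotationSum hf r]
  refine ⟨(differentiable_of_hasSum_pow hf).rotationSum r, fun w hw => ?_⟩
  by_contra hray
  have hw0 : w ≠ 0 := by rintro rfl; simp at hray
  have hf' : f = fun v => Complex.exp C * v ^ p *
      (Complex.exp ((A : ℂ) * v ^ 2 + β * v) * ∏' j, (1 - v / z j)) := by
    funext v
    rw [hG]
    ring
  rw [hf', rotationSum_const_mul_pow_mul] at hw
  obtain ⟨c, hc, hc'⟩ := hcoeff ((r + 3 * p) % 4)
  exact mul_ne_zero (mul_ne_zero (Complex.exp_ne_zero _) (pow_ne_zero _ hw0))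
    (rotationSum_ne_zero_of_tendsto hP hlim (Nat.mod_lt _ (by norm_num)) hc hc' hray) hw
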